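/- **Proposition (Dimension-shifting for complexes).** Let $G$ be a finite group and let $A^{\bullet}$ be a bounded complex of $G$-modules, i.e. a complex $(A^i)_{i\in\mathbb{Z}}$ of $\mathbb{Z}[G]$-modules with $A^i=0$ for all but finitely many $i$. Then there exists a $G$-module $A'$ such that for every subgroup $H$ of $G$ and every $q\in\mathbb{Z}$ there is an isomorphism of abelian groups $$\widehat{H}^q(H,A^{\bullet})\;\cong\;\widehat{H}^q(H,A').$$ Here, for a finite group $H$ and a bounded complex $B^{\bullet}$ of $H$-modules, $\widehat{H}^q(H,B^{\bullet})$ denotes the $q$-th cohomology group of the total complex of the double complex $\mathrm{Hom}_H(P_{\bullet},B^{\bullet})$, whose term in degree $n$ is $\prod_{i+j=n}\mathrm{Hom}_H(P_i,B^j)$, where $P_{\bullet}$ is the standard two-sided (complete) resolution of $\mathbb{Z}$ as an $H$-module: $P_n=\mathbb{Z}[H^{n+1}]$ for $n\ge 0$, with diagonal action and differential $(h_0,\dots,h_n)\mapsto\sum_{i}(-1)^i(h_0,\dots,\widehat{h_i},\dots,h_n)$; $P_{-1-n}=\mathrm{Hom}_{\mathbb{Z}}(P_n,\mathbb{Z})$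 for $n\ge 0$, with the transposed differentials; and $P_0\to P_{-1}$ is the composite $P_0\xrightarrow{\varepsilon}\mathbb{Z}\xrightarrow{\varepsilon^{*}}\mathrm{Hom}_{\mathbb{Z}}(P_0,\mathbb{Z})$ of the augmentation and its transpose. For $H\le G$, $\widehat{H}^q(H,A^{\bullet})$ is formed with the restriction of $A^{\bullet}$ to $H$, and the module $A'$, restricted to $H$, is regarded as a complex concentrated in degree $0$. -/

import Mathlib

open CategoryTheory

universe u

noncomputable section

namespace TateComplexes

/-! The constructions are made for modules over `k[G]`, `k` a commutative ring; a `G`-module in the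
usual sense is the case `k = ℤ`, i.e. an object of `Rep ℤ G`. -/

section Resolution

variable (k : Type) [CommRing k] (G : Type u) [Group G]

/-- The `k`-linear map `k[Gⁿ⁺¹] → k[Gⁿ]` with
`(g₀, …, gₙ) ↦ ∑ᵢ (-1)ⁱ (g₀, …, gᵢ₋₁, gᵢ₊₁, …, gₙ)`. -/
def boundary (n : ℕ) : MonoidAlgebra k (Fin (n + 1) → G) →ₗ[k] MonoidAlgebra k (Fin n → G) :=
  (Finsupp.linearCombination k fun g : Fin (n + 1) → G =>
    ∑ i : Fin (n + 1), (-1 : k) ^ (i : ℕ) • MonoidAlgebra.single (g ∘ i.succAbove) (1 : k)) ∘ₗ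
    (MonoidAlgebra.coeffLinearEquiv k).toLinearMap

lemma boundary_single (n : ℕ) (g : Fin (n + 1) → G) :
    boundary k G n (.single g 1) =
      ∑ i : Fin (n + 1), (-1 : k) ^ (i : ℕ) • MonoidAlgebra.single (g ∘ i.succAbove) (1 : k) := by
  simp [boundary]

lemma boundary_comp_boundary (n : ℕ) : boundary k G n ∘ₗ boundary k G (n + 1) = 0 := by
  refine MonoidAlgebra.lhom_ext' fun g => LinearMap.ext_ring ?_
  simp only [LinearMap.comp_apply, MonoidAlgebra.lsingle_apply, boundary_single, map_sum, map_smul,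
    Finset.smul_sum, smul_smul, LinearMap.zero_apply]
  rw [← Finset.sum_product']
  refine Finset.sum_involution (fun p _ => (p.1.succAbove p.2, p.2.predAbove p.1)) ?_ ?_ ?_ ?_
  · rintro ⟨i, j⟩ -
    have h : (g ∘ (i.succAbove j).succAbove) ∘ (j.predAbove i).succAbove =
        (g ∘ i.succAbove) ∘ j.succAbove := by
      funext l
      simp [Fin.succAbove_succAbove_succAbove_predAbove]
    simp only [h, ← add_smul, ← pow_add, Fin.neg_one_pow_succAbove_add_predAbove,
      add_neg_cancel, zero_smul]
  · rintro ⟨i, j⟩ - - h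
    exact Fin.succAbove_ne i j (congrArg Prod.fst h)
  · simp
  · rintro ⟨i, j⟩ -
    simp [Fin.succAbove_succAbove_predAbove, Fin.predAbove_predAbove_succAbove]

lemma boundary_ofMulAction (n : ℕ) (s : G) :
    boundary k G n ∘ₗ Representation.ofMulAction k G (Fin (n + 1) → G) s =
      Representation.ofMulAction k G (Fin n → G) s ∘ₗ boundary k G n := by
  refine MonoidAlgebra.lhom_ext' fun g => LinearMap.ext_ring ?_
  simp only [LinearMap.comp_apply, MonoidAlgebra.lsingle_apply, boundary_single, map_sum, map_smul,
    Representation.ofMulAction_single]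
  rfl

/-- The standard resolution `⋯ ⟶ k[G³] ⟶ k[G²] ⟶ k[G]` of `k` by `G`-modules, with `G` acting
diagonally. -/
def standardComplex : ChainComplex (Rep.{u} k G) ℕ :=
  ChainComplex.of (fun n => Rep.ofMulAction k G (Fin (n + 1) → G))
    (fun n => Rep.ofHom ⟨boundary k G (n + 1), boundary_ofMulAction k G (n + 1)⟩)
    (fun n => by
      ext : 2
      exact boundary_comp_boundary k G (n + 1))

lemma standardComplex_d (n : ℕ) :
    (standardComplex k G).d (n + 1) n =
      Rep.ofHom ⟨boundary k G (n + 1), boundary_ofMulAction k G (n + 1)⟩ := by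
  simp [standardComplex]

variable {k G}

/-- The `k`-linear dual `Hom(M, k)` of a `G`-module, with `(g • f) m = f (g⁻¹ • m)`. -/
def dual (M : Rep.{u} k G) : Rep.{u} k G :=
  Rep.of M.ρ.dual

/-- The transpose `f ↦ f ∘ φ` of a homomorphism of `G`-modules. -/
def dualMap {M N : Rep.{u} k G} (φ : M ⟶ N) : dual N ⟶ dual M :=
  Rep.ofHom ⟨φ.hom.toLinearMap.dualMap, fun g => LinearMap.ext fun f => LinearMap.ext fun m =>
    (congrArg (f : N →ₗ[k] k) (Rep.hom_comm_apply φ g⁻¹ m)).symm⟩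

lemma dualMap_zero (M N : Rep.{u} k G) : dualMap (0 : M ⟶ N) = 0 := by
  ext (f : N →ₗ[k] k)
  exact LinearMap.ext fun m => map_zero f

lemma dualMap_comp {M N P : Rep.{u} k G} (φ : M ⟶ N) (ψ : N ⟶ P) :
    dualMap (φ ≫ ψ) = dualMap ψ ≫ dualMap φ :=
  rfl

variable (k G)

/-- The dual `Hom(k[G], k) ⟶ Hom(k[G²], k) ⟶ ⋯` of the standard resolution. -/
def dualStandardComplex : CochainComplex (Rep.{u} k G) ℕ where
  X n := dual ((standardComplex k G).X n)
  d i j := dualMap ((standardComplex k G).d j i)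
  shape i j h := by
    rw [(standardComplex k G).shape j i (by simpa using h), dualMap_zero]
  d_comp_d' i j l _ _ := by
    rw [← dualMap_comp, HomologicalComplex.d_comp_d, dualMap_zero]

/-- The augmentation `ε : k[G] → k`, `∑ n_g g ↦ ∑ n_g`. -/
def augmentation : MonoidAlgebra k (Fin 1 → G) →ₗ[k] k :=
  (Finsupp.linearCombination k fun _ : Fin 1 → G => (1 : k)) ∘ₗ
    (MonoidAlgebra.coeffLinearEquiv k).toLinearMap

set_option linter.unusedSectionVars false in
lemma augmentation_single (g : Fin 1 → G) : augmentation k G (.single g 1) = 1 := by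
  simp [augmentation]

lemma augmentation_ofMulAction (s : G) :
    augmentation k G ∘ₗ Representation.ofMulAction k G (Fin 1 → G) s = augmentation k G := by
  refine MonoidAlgebra.lhom_ext' fun g => LinearMap.ext_ring ?_
  simp [augmentation_single]

lemma augmentation_boundary : augmentation k G ∘ₗ boundary k G 1 = 0 := by
  refine MonoidAlgebra.lhom_ext' fun g => LinearMap.ext_ring ?_
  simp [augmentation_single, boundary_single, Fin.sum_univ_succ]

/-- The composite `k[G] ⟶ k ⟶ Hom(k[G], k)` of the augmentation `ε` and its transpose:
`x ↦ (y ↦ ε(x) ε(y))`. -/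
def splice : (standardComplex k G).X 0 ⟶ (dualStandardComplex k G).X 0 :=
  Rep.ofHom (ρ := Representation.ofMulAction k G (Fin 1 → G))
    (σ := (Representation.ofMulAction k G (Fin 1 → G)).dual)
    ⟨(augmentation k G).smulRight (augmentation k G),
      fun s => LinearMap.ext fun x => LinearMap.ext fun y => by
        have h (t : G) (z : MonoidAlgebra k (Fin 1 → G)) :=
          LinearMap.congr_fun (augmentation_ofMulAction k G t) z
        exact congrArg₂ (· * ·) (h s x) (h s⁻¹ y).symm⟩

lemma d_comp_splice : (standardComplex k G).d 1 0 ≫ splice k G = 0 := by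
  rw [standardComplex_d]
  ext (x : MonoidAlgebra k (Fin 2 → G))
  refine LinearMap.ext fun y => ?_
  have h' : augmentation k G (boundary k G 1 x) = 0 :=
    LinearMap.congr_fun (augmentation_boundary k G) x
  exact (congrArg (· * augmentation k G y) h').trans (zero_mul _)

lemma splice_comp_d : splice k G ≫ (dualStandardComplex k G).d 0 1 = 0 := by
  change splice k G ≫ dualMap ((standardComplex k G).d 1 0) = 0
  rw [standardComplex_d]
  ext (x : MonoidAlgebra k (Fin 1 → G))
  refine LinearMap.ext fun (y : MonoidAlgebra k (Fin 2 → G)) => ?_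
  have h' : augmentation k G (boundary k G 1 y) = 0 :=
    LinearMap.congr_fun (augmentation_boundary k G) y
  exact (congrArg (augmentation k G x * ·) h').trans (mul_zero _)

/-- The gluing of the standard resolution and its dual along `splice`. -/
def spliceData :
    CochainComplex.ConnectData (standardComplex k G) (dualStandardComplex k G) where
  d₀ := splice k G
  comp_d₀ := d_comp_splice k G
  d₀_comp := splice_comp_d k G

/-- The standard two-sided (complete) resolution `P` of `k`,
`⋯ ⟶ k[G³] ⟶ k[G²] ⟶ k[G] ⟶ Hom(k[G], k) ⟶ Hom(k[G²], k) ⟶ ⋯`,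
written as a cochain complex: its term in cochain degree `i` is `P₋ᵢ`. So `k[Gⁿ⁺¹] = Pₙ` sits in
cochain degree `-n` and `Hom(k[Gⁿ⁺¹], k) = P₋₁₋ₙ` in cochain degree `n + 1`, for `n ≥ 0`. -/
def completeResolution : CochainComplex (Rep.{u} k G) ℤ where
  X i := (spliceData k G).cochainComplex.X (i - 1)
  d i j := (spliceData k G).cochainComplex.d (i - 1) (j - 1)
  shape i j h := (spliceData k G).cochainComplex.shape _ _ (by
    simp only [ComplexShape.up_Rel] at h ⊢
    omega)
  d_comp_d' _ _ _ _ _ := (spliceData k G).cochainComplex.d_comp_d _ _ _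

end Resolution

/-- The Tate cohomology `Ĥ^q(G, A)` of a complex `A` of `G`-modules: the cohomology in degree `q`
of the total complex of the double complex `Hom_G(P, A)`, where `P` is the standard two-sided
resolution of `ℤ`. In degree `n` the total complex consists of the families of `G`-homomorphisms
`Pᵢ ⟶ Aʲ`, `i + j = n`. If `A` is bounded, only finitely many `j` matter. -/
def tateCohomology (G : Type u) [Group G] (A : CochainComplex (Rep.{u} ℤ G) ℤ) (q : ℤ) :
    AddCommGrpCat.{u} :=
  (CochainComplex.HomComplex (completeResolution ℤ G) A).homology q

/-- The Tate cohomology `Ĥ^q(G, M)` of a `G`-module `M`, seen as a complex concentrated in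
degree `0`. -/
def tateCohomologyModule (G : Type u) [Group G] (M : Rep.{u} ℤ G) (q : ℤ) : AddCommGrpCat.{u} :=
  tateCohomology G ((HomologicalComplex.single (Rep.{u} ℤ G) (ComplexShape.up ℤ) 0).obj M) q

/-- The restriction to a subgroup `H` of a complex of `G`-modules. -/
def restrictComplex {G : Type u} [Group G] (H : Subgroup G) (A : CochainComplex (Rep.{u} ℤ G) ℤ) :
    CochainComplex (Rep.{u} ℤ H) ℤ :=
  ((Rep.resFunctor H.subtype).mapHomologicalComplex (ComplexShape.up ℤ)).obj A

end TateComplexes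

end

/-!
Dimension shifting for bounded complexes of modules over a finite group `G`.

Write `P` for the complete resolution of a subgroup `H`. Two properties of `P` carry the argument.
Its terms are projective: they are `ℤ`-free, and the identity of each is a norm `∑ h, h ∘ u ∘ h⁻¹`
of a `ℤ`-linear map (`projective_completeResolution_X`). So `Hom_H(P, -)` turns short exact
sequences of complexes into short exact sequences (`shortExact_map_homFunctor`), and there are long
exact sequences in Tate cohomology. Moreover `P` is contractible as a complex of abelian groups
(`exists_contraction_completeResolution`), so that `Hom_H(P, N)` is acyclic as soon as the identity
of `N` is the norm of a `ℤ`-linear map. This holds for the module `N` of functions `G → M`, over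
every subgroup `H` (`tateAcyclic_single_coindRep`). Contractible complexes have no Tate cohomology
either (`tateAcyclic_mappingCone_id`).

Let `A` be a complex whose last nonzero term is `A b`. The module `F` of functions `G → A b` maps
onto `A b`; let `E` be the cone of the resulting morphism from `F`, in degree `b`, to `A`. Its
quotient by `A` is `F` in degree `b - 1`, so `A` and `E` have the same Tate cohomology. The last
differential of `E` is onto, hence `E` maps onto the contractible complex `E b = E b` in the degrees
`b - 1` and `b`. The kernel `K` of this map has the Tate cohomology of `A` and ends in degree
`b - 1` (`exists_tateEquivalent_remove_last`). Repeating this until the upper end has passed both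
the lower end of `A` and `0` leaves a single module `M`, in some degree `-n ≤ 0`, with
`Ĥ^q(H, A) ≅ Ĥ^(q + n)(H, M)`. Now `M` embeds in the module of functions `G → M`, and replacing `M`
by the quotient `n` times absorbs the shift by `n` (`exists_dimension_shift_iterate`).
-/

universe v

noncomputable section

namespace TateComplexes

/-! ### Relatively projective representations -/

section TraceOne

variable {k : Type} [CommRing k] {G : Type u} [Group G]

/-- A representation `M` of a finite group is *relatively projective* when the identity of `M` is
the norm `∑ g, g ∘ u ∘ g⁻¹` of some `k`-linear endomorphism `u`. -/
def IsRelProjective [Fintype G] (M : Rep.{u} k G) : Prop :=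
  ∃ u : M →ₗ[k] M, ∀ m : M, ∑ g : G, M.ρ g (u (M.ρ g⁻¹ m)) = m

/-- The norm `∑ g, g ∘ u ∘ g⁻¹` of a `k`-linear map, as a morphism of representations. -/
def normHom [Fintype G] {M N : Rep.{u} k G} (u : M →ₗ[k] N) : M ⟶ N :=
  Rep.ofHom (ρ := M.ρ) (σ := N.ρ) ⟨∑ g : G, N.ρ g ∘ₗ u ∘ₗ M.ρ g⁻¹, fun h => by
    ext m
    simp only [LinearMap.comp_apply, LinearMap.sum_apply, map_sum]
    refine Fintype.sum_equiv (Equiv.mulLeft h⁻¹) _ _ fun g => ?_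
    simp [← Module.End.mul_apply, ← map_mul]⟩

lemma normHom_apply [Fintype G] {M N : Rep.{u} k G} (u : M →ₗ[k] N) (m : M) :
    (normHom u).hom m = ∑ g : G, N.ρ g (u (M.ρ g⁻¹ m)) := by
  change (∑ g : G, N.ρ g ∘ₗ u ∘ₗ M.ρ g⁻¹) m = _
  simp

/-- A `k`-linear lift of a morphism out of a relatively projective representation is made
equivariant by taking norms. -/
lemma IsRelProjective.projective [Fintype G] {M : Rep.{u} k G} (hM : IsRelProjective M)
    [Module.Projective k M] : Projective M where
  factors {E X} f e he := by
    obtain ⟨u, hu⟩ := hM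
    obtain ⟨s, hs⟩ := Module.projective_lifting_property e.hom.toLinearMap f.hom.toLinearMap
      ((Rep.epi_iff_surjective e).1 he)
    have hs' (x : M) : e.hom (s x) = f.hom x := LinearMap.congr_fun hs x
    refine ⟨normHom (s ∘ₗ u), ?_⟩
    ext m
    change e.hom ((normHom (s ∘ₗ u)).hom m) = f.hom m
    simp only [normHom_apply, map_sum, Rep.hom_comm_apply, LinearMap.comp_apply, hs']
    simp only [← Rep.hom_comm_apply, ← map_sum, hu]

lemma isRelProjective_ofMulAction [Fintype G] (n : ℕ) :
    IsRelProjective (Rep.ofMulAction k G (Fin (n + 1) → G)) := by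
  classical
  -- `u` projects onto the span of the tuples with first entry `1`
  let u : MonoidAlgebra k (Fin (n + 1) → G) →ₗ[k] MonoidAlgebra k (Fin (n + 1) → G) :=
    (Finsupp.linearCombination k fun g : Fin (n + 1) → G =>
      if g 0 = 1 then MonoidAlgebra.single g (1 : k) else 0) ∘ₗ
    (MonoidAlgebra.coeffLinearEquiv k).toLinearMap
  have hu (g : Fin (n + 1) → G) : u (.single g 1) = if g 0 = 1 then .single g 1 else 0 := by
    simp [u]
  refine ⟨u, fun m => ?_⟩
  suffices h : (∑ g : G, Representation.ofMulAction k G (Fin (n + 1) → G) g ∘ₗ u ∘ₗ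
      Representation.ofMulAction k G (Fin (n + 1) → G) g⁻¹) = LinearMap.id by
    simpa using LinearMap.congr_fun h m
  refine MonoidAlgebra.lhom_ext' fun g => LinearMap.ext_ring ?_
  simp only [LinearMap.comp_apply, LinearMap.sum_apply, MonoidAlgebra.lsingle_apply,
    Representation.ofMulAction_single, hu, LinearMap.id_apply]
  rw [Finset.sum_eq_single (g 0)]
  · simp [Representation.ofMulAction_single]
  · intro b _ hb
    rw [if_neg, map_zero]
    simpa [inv_mul_eq_one] using hb
  · simp

lemma IsRelProjective.dual [Fintype G] {M : Rep.{u} k G} (hM : IsRelProjective M) :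
    IsRelProjective (dual M) := by
  obtain ⟨u, hu⟩ := hM
  refine ⟨u.dualMap, fun (f : M →ₗ[k] k) => LinearMap.ext fun m => ?_⟩
  refine (LinearMap.sum_apply _ _ _).trans (Eq.trans ?_ (congrArg f (hu m)))
  rw [map_sum]
  refine Finset.sum_congr rfl fun g _ => ?_
  change f (M.ρ g⁻¹⁻¹ (u (M.ρ g⁻¹ m))) = _
  rw [inv_inv]

/-- The representation of `G` on the functions `G → M`, by `(g • f) x = g • f (g⁻¹ * x)`. -/
def coindRepresentation (M : Rep.{u} k G) : Representation k G (G → M) where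
  toFun g := LinearMap.pi fun x => M.ρ g ∘ₗ LinearMap.proj (g⁻¹ * x)
  map_one' := by ext; simp
  map_mul' g h := by ext; simp [mul_assoc]

lemma coindRepresentation_apply (M : Rep.{u} k G) (g : G) (f : G → M) (x : G) :
    coindRepresentation M g f x = M.ρ g (f (g⁻¹ * x)) := rfl

/-- The functions `G → M`, as an object of the category of representations. -/
def coindRep (M : Rep.{u} k G) : Rep.{u} k G :=
  Rep.of (coindRepresentation M)

/-- The embedding of `M` into `G → M` as the constant functions. -/
def toCoind (M : Rep.{u} k G) : M ⟶ coindRep M :=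
  Rep.ofHom (ρ := M.ρ) (σ := coindRepresentation M) ⟨LinearMap.pi fun _ => LinearMap.id, fun _ => rfl⟩

instance (M : Rep.{u} k G) : Mono (toCoind M) :=
  (Rep.mono_iff_injective _).2 fun _ _ h => congrFun h (1 : G)

/-- The projection `f ↦ ∑ x, f x` of `G → M` onto `M`. -/
def fromCoind [Fintype G] (M : Rep.{u} k G) : coindRep M ⟶ M :=
  Rep.ofHom (ρ := coindRepresentation M) (σ := M.ρ) ⟨∑ x : G, LinearMap.proj x, fun g => by
    refine LinearMap.ext fun (f : G → M) => ?_
    simp only [LinearMap.comp_apply, LinearMap.sum_apply, LinearMap.proj_apply, map_sum,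
      coindRepresentation_apply]
    exact Fintype.sum_equiv (Equiv.mulLeft g⁻¹) _ _ fun x => rfl⟩

instance [Fintype G] (M : Rep.{u} k G) : Epi (fromCoind M) := by
  classical
  refine (Rep.epi_iff_surjective _).2 fun m => ⟨(Pi.single 1 m : G → M), ?_⟩
  change (∑ x : G, LinearMap.proj (R := k) (φ := fun _ : G => M.V) x) (Pi.single 1 m : G → M) = m
  rw [LinearMap.sum_apply]
  exact Fintype.sum_pi_single' (1 : G) m

lemma isRelProjective_coindRep (M : Rep.{u} k G) (H : Subgroup G) [Fintype H] :
    IsRelProjective (Rep.res H.subtype (coindRep M)) := by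
  classical
  obtain ⟨T, hT, -⟩ := H.exists_isComplement_right 1
  -- `u` restricts a function to a set `T` of representatives of the right cosets of `H`
  let u : (G → M) →ₗ[k] (G → M) :=
    LinearMap.pi fun x => if x ∈ T then LinearMap.proj x else 0
  have hu (f : G → M) (x : G) : u f x = if x ∈ T then f x else 0 := by
    by_cases hx : x ∈ T <;> simp [u, hx]
  refine ⟨u, fun (f : G → M) => funext fun x => ?_⟩
  refine (Finset.sum_apply (M := fun _ : G => M.V) x _ _).trans ?_
  change ∑ h : H, M.ρ h (u (coindRepresentation M ((h⁻¹ : H) : G) f) ((h : G)⁻¹ * x)) = f x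
  simp only [hu, coindRepresentation_apply]
  obtain ⟨⟨h₀, t₀⟩, hx, huniq⟩ := hT.existsUnique x
  refine (Finset.sum_eq_single (ι := H) (M := M.V) h₀ (fun h _ hh => ?_) (by simp)).trans ?_
  · rw [if_neg, map_zero]
    intro hmem
    exact hh (congrArg Prod.fst (huniq (h, ⟨_, hmem⟩) (by simp)))
  · rw [if_pos]
    · simp
    · rw [← hx]
      simp

end TraceOne

/-! ### The complete resolution -/

section Contraction

variable (k : Type) [CommRing k] (G : Type u) [Group G]

/-- The `k`-linear map `k[Gⁿ] → k[Gⁿ⁺¹]` with `(g₁, …, gₙ) ↦ (1, g₁, …, gₙ)`. -/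
def coneMap (n : ℕ) : MonoidAlgebra k (Fin n → G) →ₗ[k] MonoidAlgebra k (Fin (n + 1) → G) :=
  (Finsupp.linearCombination k fun g : Fin n → G =>
    MonoidAlgebra.single (Fin.cons 1 g : Fin (n + 1) → G) (1 : k)) ∘ₗ
    (MonoidAlgebra.coeffLinearEquiv k).toLinearMap

lemma coneMap_single (n : ℕ) (g : Fin n → G) :
    coneMap k G n (.single g 1) = .single (Fin.cons 1 g : Fin (n + 1) → G) 1 := by
  simp [coneMap]

lemma boundary_coneMap_add (n : ℕ) (x : MonoidAlgebra k (Fin (n + 1) → G)) :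
    boundary k G (n + 1) (coneMap k G (n + 1) x) + coneMap k G n (boundary k G n x) = x := by
  suffices h : boundary k G (n + 1) ∘ₗ coneMap k G (n + 1) + coneMap k G n ∘ₗ boundary k G n =
      LinearMap.id from LinearMap.congr_fun h x
  refine MonoidAlgebra.lhom_ext' fun g => LinearMap.ext_ring ?_
  simp only [LinearMap.comp_apply, LinearMap.add_apply, MonoidAlgebra.lsingle_apply,
    boundary_single, coneMap_single, map_sum, map_smul, LinearMap.id_apply]
  have h (j : Fin (n + 1)) : (Fin.cons 1 g : Fin (n + 2) → G) ∘ j.succ.succAbove =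
      Fin.cons 1 (g ∘ j.succAbove) := by
    funext l
    cases l using Fin.cases <;> simp
  have h0 : (Fin.cons 1 g : Fin (n + 2) → G) ∘ (0 : Fin (n + 2)).succAbove = g := by
    funext l
    simp
  rw [Fin.sum_univ_succ]
  simp only [h, h0, Fin.val_zero, Fin.val_succ, pow_zero, one_smul, pow_succ, mul_neg_one,
    neg_smul, Finset.sum_neg_distrib, neg_add_cancel_right]

/-- In degree `0`, `coneMap ∘ boundary` is `x ↦ ε(x) • 1`. -/
lemma coneMap_boundary_zero (x : MonoidAlgebra k (Fin 1 → G)) :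
    coneMap k G 0 (boundary k G 0 x) = augmentation k G x • .single (1 : Fin 1 → G) 1 := by
  suffices h : coneMap k G 0 ∘ₗ boundary k G 0 =
      (augmentation k G).smulRight (.single (1 : Fin 1 → G) 1) from LinearMap.congr_fun h x
  refine MonoidAlgebra.lhom_ext' fun g => LinearMap.ext_ring ?_
  have h1 : (Fin.cons 1 (g ∘ Fin.succ) : Fin 1 → G) = 1 := by
    funext l
    obtain rfl := Fin.fin_one_eq_zero l
    rfl
  simp [boundary_single, coneMap_single, augmentation_single, h1]

lemma standardComplex_d_apply (n : ℕ) (x : MonoidAlgebra k (Fin (n + 2) → G)) :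
    ((standardComplex k G).d (n + 1) n).hom x = boundary k G (n + 1) x := by
  rw [standardComplex_d]
  rfl

/-- The splice of the standard resolution and its dual is contractible as a complex of
`k`-modules. -/
lemma exists_contraction_spliceData {i j l : ℤ} (hij : i + 1 = j) (hjl : j + 1 = l) :
    ∃ (s : (spliceData k G).cochainComplex.X j →ₗ[k] (spliceData k G).cochainComplex.X i)
      (t : (spliceData k G).cochainComplex.X l →ₗ[k] (spliceData k G).cochainComplex.X j),
      ∀ x, ((spliceData k G).cochainComplex.d i j).hom (s x) +
        t (((spliceData k G).cochainComplex.d j l).hom x) = x := by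
  -- at the splice, `f ↦ f 1 • 1` from the dual of `k[G]` to `k[G]` is a homotopy
  let e : MonoidAlgebra k (Fin 1 → G) := .single 1 1
  let r : (MonoidAlgebra k (Fin 1 → G) →ₗ[k] k) →ₗ[k] MonoidAlgebra k (Fin 1 → G) :=
    (LinearMap.applyₗ e).smulRight e
  obtain (_ | n) | (_ | n) := j
  · obtain rfl : i = Int.negSucc 0 := by lia
    obtain rfl : l = Int.ofNat 1 := by lia
    refine ⟨r, (coneMap k G 1).dualMap, fun (f : MonoidAlgebra k (Fin 1 → G) →ₗ[k] k) => ?_⟩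
    refine LinearMap.ext fun (x : MonoidAlgebra k (Fin 1 → G)) => ?_
    change augmentation k G (f e • e) * augmentation k G x +
      f (((standardComplex k G).d 1 0).hom (coneMap k G 1 x)) = f x
    rw [standardComplex_d_apply, map_smul, augmentation_single, smul_eq_mul, mul_one]
    conv_rhs => rw [← boundary_coneMap_add k G 0 x, coneMap_boundary_zero, map_add, map_smul]
    rw [smul_eq_mul, mul_comm, add_comm]
  · obtain rfl : i = Int.ofNat n := by lia
    obtain rfl : l = Int.ofNat (n + 2) := by lia
    refine ⟨(coneMap k G (n + 1)).dualMap, (coneMap k G (n + 2)).dualMap,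
      fun (f : MonoidAlgebra k (Fin (n + 2) → G) →ₗ[k] k) => ?_⟩
    refine LinearMap.ext fun (x : MonoidAlgebra k (Fin (n + 2) → G)) => ?_
    change f (coneMap k G (n + 1) (((standardComplex k G).d (n + 1) n).hom x)) +
      f (((standardComplex k G).d (n + 2) (n + 1)).hom (coneMap k G (n + 2) x)) = f x
    rw [standardComplex_d_apply, standardComplex_d_apply, add_comm]
    exact (map_add f _ _).symm.trans (congrArg f (boundary_coneMap_add k G (n + 1) x))
  · obtain rfl : i = Int.negSucc 1 := by lia
    obtain rfl : l = Int.ofNat 0 := by lia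
    refine ⟨coneMap k G 1, r, fun (x : MonoidAlgebra k (Fin 1 → G)) => ?_⟩
    have h : (augmentation k G x * augmentation k G e) • e = coneMap k G 0 (boundary k G 0 x) := by
      rw [augmentation_single, mul_one, coneMap_boundary_zero]
    exact (congrArg₂ (fun a b : MonoidAlgebra k (Fin 1 → G) => a + b)
      (standardComplex_d_apply k G 0 _) h).trans
      (boundary_coneMap_add k G 0 x)
  · obtain rfl : i = Int.negSucc (n + 2) := by lia
    obtain rfl : l = Int.negSucc n := by lia
    refine ⟨coneMap k G (n + 2), coneMap k G (n + 1),
      fun (x : MonoidAlgebra k (Fin (n + 2) → G)) => ?_⟩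
    exact (congrArg₂ (fun a b : MonoidAlgebra k (Fin (n + 2) → G) => a + b)
      (standardComplex_d_apply k G (n + 1) _) (congrArg (coneMap k G (n + 1)) (standardComplex_d_apply k G n x))).trans
      (boundary_coneMap_add k G (n + 1) x)

lemma exists_contraction_completeResolution {i j l : ℤ} (hij : i + 1 = j) (hjl : j + 1 = l) :
    ∃ (s : (completeResolution k G).X j →ₗ[k] (completeResolution k G).X i)
      (t : (completeResolution k G).X l →ₗ[k] (completeResolution k G).X j),
      ∀ x, ((completeResolution k G).d i j).hom (s x) +
        t (((completeResolution k G).d j l).hom x) = x :=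
  exists_contraction_spliceData k G (i := i - 1) (j := j - 1) (l := l - 1) (by lia) (by lia)

variable {k G}

/-- A morphism from the complete resolution to a relatively projective representation that vanishes
on boundaries factors through the differential: it does so `k`-linearly, and taking norms makes the
factorization equivariant. -/
lemma IsRelProjective.exists_factorization [Fintype G] {M : Rep.{u} k G} (hM : IsRelProjective M)
    (i j l : ℤ) (hij : i + 1 = j) (hjl : j + 1 = l) (f : (completeResolution k G).X j ⟶ M)
    (hf : (completeResolution k G).d i j ≫ f = 0) :
    ∃ g : (completeResolution k G).X l ⟶ M, (completeResolution k G).d j l ≫ g = f := by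
  obtain ⟨u, hu⟩ := hM
  obtain ⟨s, t, hst⟩ := exists_contraction_completeResolution k G hij hjl
  refine ⟨normHom (u ∘ₗ f.hom.toLinearMap ∘ₗ t), ?_⟩
  have hft (x : (completeResolution k G).X j) :
      f.hom (t (((completeResolution k G).d j l).hom x)) = f.hom x := by
    have h : f.hom (((completeResolution k G).d i j).hom (s x)) = 0 :=
      congrArg (fun φ : (completeResolution k G).X i ⟶ M => φ.hom (s x)) hf
    conv_rhs => rw [← hst x]
    rw [map_add, h, zero_add]
  ext x
  change (normHom (u ∘ₗ f.hom.toLinearMap ∘ₗ t)).hom (((completeResolution k G).d j l).hom x) =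
    f.hom x
  rw [normHom_apply, ← hu (f.hom x)]
  refine Finset.sum_congr rfl fun h _ => congrArg (fun y => M.ρ h (u y)) ?_
  rw [← Rep.hom_comm_apply, ← Rep.hom_comm_apply]
  exact hft _

lemma isRelProjective_completeResolution [Fintype G] (i : ℤ) :
    IsRelProjective ((completeResolution k G).X i) := by
  change IsRelProjective ((spliceData k G).cochainComplex.X (i - 1))
  obtain n | n := i - 1
  · exact (isRelProjective_ofMulAction n).dual
  · exact isRelProjective_ofMulAction n

lemma projective_completeResolution_X [Fintype G] (i : ℤ) :
    Projective ((completeResolution k G).X i) := by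
  have : Module.Projective k ((completeResolution k G).X i) := by
    change Module.Projective k ((spliceData k G).cochainComplex.X (i - 1))
    obtain n | n := i - 1
    · have : Module.Finite k (MonoidAlgebra k (Fin (n + 1) → G)) :=
        .equiv (MonoidAlgebra.coeffLinearEquiv k).symm
      have : Module.Free k (MonoidAlgebra k (Fin (n + 1) → G)) :=
        .of_equiv (MonoidAlgebra.coeffLinearEquiv k).symm
      exact inferInstanceAs
        (Module.Projective k (Module.Dual k (MonoidAlgebra k (Fin (n + 1) → G))))
    · have : Module.Free k (MonoidAlgebra k (Fin (n + 1) → G)) :=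
        .of_equiv (MonoidAlgebra.coeffLinearEquiv k).symm
      exact inferInstanceAs (Module.Projective k (MonoidAlgebra k (Fin (n + 1) → G)))
  exact (isRelProjective_completeResolution i).projective

end Contraction

/-! ### Complexes of homomorphisms -/

section HomFunctor

open Limits CochainComplex HomComplex

variable {C : Type u} [Category.{v} C] [Abelian C]

/-- The functor `K ↦ Hom(P, K)` from complexes to complexes of abelian groups. -/
def homFunctor (P : CochainComplex C ℤ) :
    CochainComplex C ℤ ⥤ CochainComplex AddCommGrpCat.{v} ℤ where
  obj K := HomComplex P K
  map {K L} φ :=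
    { f n := AddCommGrpCat.ofHom
        { toFun z := z.comp (Cochain.ofHom φ) (add_zero n)
          map_zero' := by simp
          map_add' := by simp }
      comm' i j _ := by
        ext z
        exact δ_comp_ofHom z φ j }
  map_id K := by
    ext n z
    exact Cochain.comp_id z
  map_comp φ ψ := by
    ext n z
    exact (congrArg (z.comp · (add_zero n)) (Cochain.ofHom_comp φ ψ)).trans
      (Cochain.comp_assoc_of_third_is_zero_cochain z _ _ _).symm

lemma homFunctor_map_f_v (P : CochainComplex C ℤ) {K L : CochainComplex C ℤ} (φ : K ⟶ L) (n : ℤ)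
    (z : Cochain P K n) (p q : ℤ) (hpq : p + n = q) :
    Cochain.v (((homFunctor P).map φ).f n z) p q hpq = z.v p q hpq ≫ φ.f q :=
  Cochain.comp_zero_cochain_v _ _ _ _ _ |>.trans (by simp)

instance (P : CochainComplex C ℤ) : (homFunctor P).PreservesZeroMorphisms where
  map_zero K L := by
    ext n z
    exact Cochain.ext _ _ fun p q hpq => by
      refine (homFunctor_map_f_v P 0 n z p q hpq).trans ?_
      simp
      rfl

/-- `Hom(P, -)` is exact when every term of `P` is projective. -/
lemma shortExact_map_homFunctor (P : CochainComplex C ℤ) (hP : ∀ i, Projective (P.X i))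
    {S : ShortComplex (CochainComplex C ℤ)} (hS : S.ShortExact) :
    (S.map (homFunctor P)).ShortExact := by
  have hS' (q : ℤ) : (S.map (HomologicalComplex.eval C (ComplexShape.up ℤ) q)).ShortExact :=
    hS.map_of_exact _
  refine HomologicalComplex.shortExact_of_degreewise_shortExact _ fun n => ?_
  have hmono (q : ℤ) : Mono (S.f.f q) := (hS' q).mono_f
  have hepi (q : ℤ) : Epi (S.g.f q) := (hS' q).epi_g
  have hmono' (q : ℤ) : Mono (S.map (HomologicalComplex.eval C (ComplexShape.up ℤ) q)).f :=
    hmono q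
  refine ShortComplex.ShortExact.mk' ?_ ?_ ?_
  · rw [ShortComplex.ab_exact_iff]
    intro (z : Cochain P S.X₂ n) hz
    have hz' (p q : ℤ) (hpq : p + n = q) : z.v p q hpq ≫ S.g.f q = 0 :=
      (homFunctor_map_f_v P S.g n z p q hpq).symm.trans
        (congrArg (fun w : Cochain P S.X₃ n => w.v p q hpq) hz)
    refine ⟨(Cochain.mk fun p q hpq => (hS' q).exact.lift (z.v p q hpq) (hz' p q hpq) :
      Cochain P S.X₁ n), ?_⟩
    refine Cochain.ext _ _ fun p q hpq => ?_
    exact (homFunctor_map_f_v P S.f n _ p q hpq).trans ((hS' q).exact.lift_f _ _)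
  · rw [AddCommGrpCat.mono_iff_injective]
    intro (z : Cochain P S.X₁ n) (w : Cochain P S.X₁ n) h
    refine Cochain.ext _ _ fun p q hpq => ?_
    rw [← cancel_mono (S.f.f q), ← homFunctor_map_f_v, ← homFunctor_map_f_v]
    exact congrArg (fun w : Cochain P S.X₂ n => w.v p q hpq) h
  · rw [AddCommGrpCat.epi_iff_surjective]
    intro (z : Cochain P S.X₃ n)
    refine ⟨(Cochain.mk fun p q hpq => Projective.factorThru (z.v p q hpq) (S.g.f q) :
      Cochain P S.X₂ n), ?_⟩
    refine Cochain.ext _ _ fun p q hpq => ?_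
    exact (homFunctor_map_f_v P S.g n _ p q hpq).trans (Projective.factorThru_comp _ _)

/-- `Hom(P, K)` is acyclic for a contractible complex `K`. -/
lemma acyclic_homFunctor_of_homotopy (P : CochainComplex C ℤ) {K : CochainComplex C ℤ}
    (h : Homotopy (𝟙 K) 0) : ((homFunctor P).obj K).Acyclic := by
  intro n
  rw [HomologicalComplex.exactAt_iff_isZero_homology]
  have hK : IsZero ((HomotopyCategory.quotient C (ComplexShape.up ℤ)).obj K) :=
    (HomotopyCategory.isZero_quotient_obj_iff _).2 ⟨h⟩
  have hKn : IsZero ((HomotopyCategory.quotient C (ComplexShape.up ℤ)).obj (K⟦n⟧)) :=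
    ((CategoryTheory.shiftFunctor _ n).map_isZero hK).of_iso
      (((HomotopyCategory.quotient C (ComplexShape.up ℤ)).commShiftIso n).app K)
  have : Subsingleton ((HomComplex P K).homology n) :=
    ⟨fun x y => ((homologyAddEquiv P K n).trans CohomologyClass.homAddEquiv).injective
      (hKn.eq_of_tgt _ _)⟩
  exact @AddCommGrpCat.isZero_of_subsingleton ((HomComplex P K).homology n) this

/-- If every morphism `P i ⟶ M` that vanishes on boundaries factors through the differential, then
`Hom(P, -)` is acyclic on `M`, put in any degree. -/
lemma acyclic_homFunctor_single (P : CochainComplex C ℤ) (M : C)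
    (h : ∀ (i j l : ℤ), i + 1 = j → j + 1 = l → ∀ f : P.X j ⟶ M, P.d i j ≫ f = 0 →
      ∃ g : P.X l ⟶ M, P.d j l ≫ g = f) (b : ℤ) :
    ((homFunctor P).obj ((HomologicalComplex.single C (ComplexShape.up ℤ) b).obj M)).Acyclic := by
  intro n
  rw [HomologicalComplex.exactAt_iff_isZero_homology]
  have : Subsingleton (CohomologyClass P ((CochainComplex.singleFunctor C b).obj M) n) := by
    refine subsingleton_of_forall_eq 0 fun x => ?_
    obtain ⟨x, rfl⟩ := x.mk_surjective
    obtain ⟨f, hf, rfl⟩ := Cocycle.toSingleMk_surjective x (b - n) (by lia) (b - n - 1) (by lia)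
    rw [CohomologyClass.mk_eq_zero_iff,
      Cocycle.toSingleMk_mem_coboundaries_iff _ _ _ _ _ (b - n + 1) rfl]
    exact h _ _ _ (by lia) rfl f hf
  have : Subsingleton
      ((HomComplex P ((CochainComplex.singleFunctor C b).obj M)).homology n) :=
    (homologyAddEquiv P _ n).injective.subsingleton
  exact @AddCommGrpCat.isZero_of_subsingleton
    ((HomComplex P ((CochainComplex.singleFunctor C b).obj M)).homology n) this

/-- Cohomology of `Hom(P, M)` for `M` in degree `m` and in degree `0`. -/
lemma nonempty_homology_single_iso (P : CochainComplex C ℤ) (M : C) (m q : ℤ) :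
    Nonempty (((homFunctor P).obj
        ((HomologicalComplex.single C (ComplexShape.up ℤ) m).obj M)).homology q ≅
      ((homFunctor P).obj
        ((HomologicalComplex.single C (ComplexShape.up ℤ) 0).obj M)).homology (q - m)) := by
  let Q := HomotopyCategory.quotient C (ComplexShape.up ℤ)
  let s (i : ℤ) := (CochainComplex.singleFunctor C i).obj M
  have e : Q.obj ((s m)⟦q⟧) ≅ Q.obj ((s 0)⟦q - m⟧) := Q.mapIso
    (((CochainComplex.singleFunctors C).shiftIso q (m - q) m (by lia)).app M ≪≫
      (((CochainComplex.singleFunctors C).shiftIso (q - m) (m - q) 0 (by lia)).app M).symm)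
  let e' : (Q.obj P ⟶ Q.obj ((s m)⟦q⟧)) ≃+ (Q.obj P ⟶ Q.obj ((s 0)⟦q - m⟧)) :=
    { toFun f := f ≫ e.hom
      invFun f := f ≫ e.inv
      left_inv f := by simp
      right_inv f := by simp
      map_add' f g := by simp }
  exact ⟨AddEquiv.toAddCommGrpIso <|
    ((homologyAddEquiv P (s m) q).trans CohomologyClass.homAddEquiv).trans <| e'.trans
      ((homologyAddEquiv P (s 0) (q - m)).trans CohomologyClass.homAddEquiv).symm⟩

end HomFunctor

/-! ### Shortening a complex -/

section Truncation

open Limits CochainComplex HomComplex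

variable {C : Type u} [Category.{v} C] [Abelian C]

/-- The morphism `K ⟶ mappingCone (𝟙 L)` with second component a given cochain `β`; the first
component is then forced to be `-δ β`. -/
def toContractible {K L : CochainComplex C ℤ} (β : Cochain K L 0) : K ⟶ mappingCone (𝟙 L) :=
  mappingCone.lift (𝟙 L) (-Cocycle.mk (δ 0 1 β) 2 rfl (δ_δ _ _ _ _)) β (by simp)

/-- The short exact sequence `0 ⟶ L ⟶ mappingCone φ ⟶ K⟦1⟧ ⟶ 0`. -/
lemma shortExact_mappingCone {K L : CochainComplex C ℤ} (φ : K ⟶ L) :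
    (mappingCone.triangleRotateShortComplex φ).ShortExact :=
  HomologicalComplex.shortExact_of_degreewise_shortExact _ fun n =>
    (mappingCone.triangleRotateShortComplexSplitting φ n).shortExact

/-- A complex whose last differential is an epimorphism `E (b - 1) ⟶ E b` maps onto a contractible
complex with kernel vanishing in the degrees `≥ b`. -/
lemma exists_shortExact_contractible (E : CochainComplex C ℤ) (b : ℤ)
    (hE : ∀ i, b < i → IsZero (E.X i)) [Epi (E.d (b - 1) b)] :
    ∃ (K L : CochainComplex C ℤ) (ι : K ⟶ E) (κ : E ⟶ mappingCone (𝟙 L)) (w : ι ≫ κ = 0),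
      (ShortComplex.mk ι κ w).ShortExact ∧ (∀ i, b ≤ i → IsZero (K.X i)) ∧
      ∀ i, IsZero (E.X i) → IsZero (K.X i) := by
  let L := (CochainComplex.singleFunctor C b).obj (E.X b)
  have hL (i : ℤ) (hi : i ≠ b) : IsZero (L.X i) := HomologicalComplex.isZero_single_obj_X _ _ _ _ hi
  let β : Cochain E L 0 := Cochain.toSingleMk (𝟙 (E.X b)) (add_zero b)
  let e : L.X b ≅ E.X b := HomologicalComplex.singleObjXSelf (ComplexShape.up ℤ) b (E.X b)
  have hβ : β.v b b (add_zero b) = e.inv :=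
    (Cochain.toSingleMk_v (𝟙 (E.X b)) (add_zero b)).trans (Category.id_comp _)
  let κ := toContractible β
  -- in degree `b` the cone of `𝟙 L` is `L b`, and `κ` is the identity there
  have hsnd : κ.f b ≫ (mappingCone.snd (𝟙 L)).v b b (add_zero b) = e.inv :=
    (mappingCone.lift_f_snd_v ..).trans hβ
  have hsndmono : Mono ((mappingCone.snd (𝟙 L)).v b b (add_zero b)) :=
    ⟨fun f g h => mappingCone.ext_to _ _ (b + 1) rfl ((hL (b + 1) (by lia)).eq_of_tgt _ _) h⟩
  have hmono : Mono (κ.f b) := by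
    have : Mono (κ.f b ≫ (mappingCone.snd (𝟙 L)).v b b (add_zero b)) := by
      rw [hsnd]; infer_instance
    exact mono_of_mono _ ((mappingCone.snd (𝟙 L)).v b b (add_zero b))
  have hepi : Epi κ := by
    refine HomologicalComplex.epi_of_epi_f _ fun i => ?_
    by_cases hi : i = b
    · subst hi
      have : IsIso ((mappingCone.snd (𝟙 L)).v i i (add_zero i)) :=
        have : IsSplitEpi ((mappingCone.snd (𝟙 L)).v i i (add_zero i)) :=
          ⟨⟨⟨(mappingCone.inr (𝟙 L)).f i, mappingCone.inr_f_snd_v ..⟩⟩⟩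
        isIso_of_mono_of_isSplitEpi _
      rw [(IsIso.eq_comp_inv _).2 hsnd]
      infer_instance
    · by_cases hi' : i + 1 = b
      · obtain rfl : i = b - 1 := by lia
        -- in degree `b - 1` the cone of `𝟙 L` is again `L b`, and `κ` is the differential of `E`
        have hfst : κ.f (b - 1) ≫ (mappingCone.fst (𝟙 L)).1.v (b - 1) b hi' =
            E.d (b - 1) b ≫ e.inv := by
          refine (mappingCone.lift_f_fst_v ..).trans ?_
          change -(δ 0 1 β).v (b - 1) b hi' = _
          rw [δ_v 0 1 rfl β (b - 1) b hi' (b - 1) b rfl hi', hβ]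
          have h0 : β.v (b - 1) (b - 1) (add_zero _) = 0 := (hL _ hi).eq_of_tgt _ _
          rw [h0]
          simp
        have hfstmono : Mono ((mappingCone.fst (𝟙 L)).1.v (b - 1) b hi') :=
          ⟨fun f g h => mappingCone.ext_to _ _ b hi' h ((hL (b - 1) hi).eq_of_tgt _ _)⟩
        have : IsIso ((mappingCone.fst (𝟙 L)).1.v (b - 1) b hi') :=
          have : IsSplitEpi ((mappingCone.fst (𝟙 L)).1.v (b - 1) b hi') :=
            ⟨⟨⟨(mappingCone.inl (𝟙 L)).v b (b - 1) (by lia), mappingCone.inl_v_fst_v ..⟩⟩⟩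
          isIso_of_mono_of_isSplitEpi _
        rw [(IsIso.eq_comp_inv _).2 hfst]
        infer_instance
      · have : IsZero ((mappingCone (𝟙 L)).X i) :=
          (mappingCone.isZero_X_iff _ _).2 ⟨hL _ hi', hL _ hi⟩
        exact ⟨fun f g _ => this.eq_of_src f g⟩
  -- the kernel vanishes wherever `E` does, and in degree `b`, where `κ` is a monomorphism
  have hS : (ShortComplex.mk (kernel.ι κ) κ (kernel.condition κ)).ShortExact :=
    .mk' (ShortComplex.exact_kernel κ) inferInstance hepi
  have hker (i : ℤ) : Mono ((kernel.ι κ).f i) := inferInstance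
  have hzero (i : ℤ) (hi : IsZero (E.X i)) : IsZero ((kernel κ).X i) :=
    have := hker i
    IsZero.of_mono ((kernel.ι κ).f i) hi
  refine ⟨_, L, _, κ, _, hS, fun i hi => ?_, hzero⟩
  obtain rfl | hi := hi.eq_or_lt
  · have h : (kernel.ι κ).f b = 0 := by
      rw [← cancel_mono (κ.f b), ← HomologicalComplex.comp_f, kernel.condition, zero_comp]
      rfl
    have := hker b
    exact IsZero.of_mono_eq_zero _ h
  · exact hzero i (hE i hi)

/-- If the last term `A b` of a complex is covered by `F`, this is the cover as a morphism of
complexes. -/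
lemma exists_hom_from_single (A : CochainComplex C ℤ) (b : ℤ)
    (hA : ∀ i, b < i → IsZero (A.X i)) {F : C} (π : F ⟶ A.X b) [Epi π] :
    ∃ ψ : (CochainComplex.singleFunctor C b).obj F ⟶ A, Epi (ψ.f b) := by
  let J := (CochainComplex.singleFunctor C b).obj F
  let e : J.X b ≅ F := HomologicalComplex.singleObjXSelf (ComplexShape.up ℤ) b F
  let ψ : J ⟶ A := HomologicalComplex.mkHomFromSingle π fun i hi =>
    (hA i (by simp at hi; lia)).eq_of_tgt _ _
  have h : ψ.f b = e.hom ≫ π := HomologicalComplex.mkHomFromSingle_f _ _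
  exact ⟨ψ, by rw [h]; infer_instance⟩

/-- The cone of a morphism `F ⟶ A`, for `F` in the last degree `b` of `A` and `F ⟶ A b` an
epimorphism, has an epimorphism as its last differential. -/
lemma epi_d_mappingCone {A : CochainComplex C ℤ} {b : ℤ} {F : C}
    (ψ : (CochainComplex.singleFunctor C b).obj F ⟶ A) [Epi (ψ.f b)] :
    Epi ((mappingCone ψ).d (b - 1) b) := by
  let J := (CochainComplex.singleFunctor C b).obj F
  have hJ (i : ℤ) (hi : i ≠ b) : IsZero (J.X i) := HomologicalComplex.isZero_single_obj_X _ _ _ _ hi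
  have h : (mappingCone.inl ψ).v b (b - 1) (by lia) ≫ (mappingCone ψ).d (b - 1) b =
      ψ.f b ≫ (mappingCone.inr ψ).f b := by
    rw [mappingCone.inl_v_d ψ b (b - 1) (b + 1) (by lia) (by lia),
      (hJ (b + 1) (by lia)).eq_of_tgt (HomologicalComplex.d _ b (b + 1)) 0, zero_comp, sub_zero]
  have hinr : Epi ((mappingCone.inr ψ).f b) :=
    ⟨fun f g hfg => mappingCone.ext_from _ (b + 1) b rfl
      ((hJ (b + 1) (by lia)).eq_of_src _ _) hfg⟩
  exact epi_of_epi_fac h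

end Truncation

/-! ### Tate cohomology over all subgroups -/

section Tate

open Limits CochainComplex

variable {G : Type u} [Group G]

/-- The functor sending a complex `A` of `G`-modules to the complex `Hom_H(P, A)`, where `P` is the
complete resolution for the subgroup `H`. -/
def tateFunctor (H : Subgroup G) :
    CochainComplex (Rep.{u} ℤ G) ℤ ⥤ CochainComplex AddCommGrpCat.{u} ℤ :=
  (Rep.resFunctor H.subtype).mapHomologicalComplex (ComplexShape.up ℤ) ⋙
    homFunctor (completeResolution ℤ H)

instance (H : Subgroup G) : (tateFunctor H).PreservesZeroMorphisms :=
  inferInstanceAs ((_ ⋙ homFunctor (completeResolution ℤ H)).PreservesZeroMorphisms)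

lemma shortExact_map_tateFunctor [Finite G] (H : Subgroup G)
    {S : ShortComplex (CochainComplex (Rep.{u} ℤ G) ℤ)} (hS : S.ShortExact) :
    (S.map (tateFunctor H)).ShortExact := by
  have := Fintype.ofFinite H
  have hS' : (S.map ((Rep.resFunctor H.subtype).mapHomologicalComplex
      (ComplexShape.up ℤ))).ShortExact :=
    HomologicalComplex.shortExact_of_degreewise_shortExact _ fun n =>
      (Rep.shortExact_res H.subtype).2
        (hS.map_of_exact (HomologicalComplex.eval _ (ComplexShape.up ℤ) n))
  exact shortExact_map_homFunctor _ projective_completeResolution_X hS'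

/-- A complex of `G`-modules is Tate acyclic when its Tate cohomology vanishes for all subgroups. -/
def TateAcyclic (A : CochainComplex (Rep.{u} ℤ G) ℤ) : Prop :=
  ∀ H : Subgroup G, ((tateFunctor H).obj A).Acyclic

/-- Two complexes of `G`-modules are Tate equivalent when their Tate cohomology groups are
isomorphic for all subgroups and in all degrees. -/
def TateEquivalent (A B : CochainComplex (Rep.{u} ℤ G) ℤ) : Prop :=
  ∀ (H : Subgroup G) (q : ℤ),
    Nonempty (((tateFunctor H).obj A).homology q ≅ ((tateFunctor H).obj B).homology q)

lemma TateEquivalent.symm {A B : CochainComplex (Rep.{u} ℤ G) ℤ} (h : TateEquivalent A B) :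
    TateEquivalent B A := fun H q => ⟨(h H q).some.symm⟩

lemma TateEquivalent.trans {A B D : CochainComplex (Rep.{u} ℤ G) ℤ} (h : TateEquivalent A B)
    (h' : TateEquivalent B D) : TateEquivalent A D :=
  fun H q => ⟨(h H q).some ≪≫ (h' H q).some⟩

lemma TateEquivalent.of_iso {A B : CochainComplex (Rep.{u} ℤ G) ℤ} (e : A ≅ B) :
    TateEquivalent A B :=
  fun H q => ⟨(HomologicalComplex.homologyFunctor _ _ q).mapIso ((tateFunctor H).mapIso e)⟩

lemma TateAcyclic.of_iso {A B : CochainComplex (Rep.{u} ℤ G) ℤ} (e : A ≅ B)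
    (hA : TateAcyclic A) : TateAcyclic B := fun H i =>
  (hA H i).of_iso ((tateFunctor H).mapIso e)

lemma TateEquivalent.of_shortExact [Finite G] {S : ShortComplex (CochainComplex (Rep.{u} ℤ G) ℤ)}
    (hS : S.ShortExact) (h : TateAcyclic S.X₃) : TateEquivalent S.X₁ S.X₂ := fun H q => by
  have hT := shortExact_map_tateFunctor H hS
  have hz (i : ℤ) : IsZero ((S.map (tateFunctor H)).X₃.homology i) := (h H i).isZero_homology
  have : Mono (HomologicalComplex.homologyMap (S.map (tateFunctor H)).f q) :=
    (hT.homology_exact₁ (q - 1) q (by simp)).mono_g ((hz _).eq_of_src _ _)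
  have : Epi (HomologicalComplex.homologyMap (S.map (tateFunctor H)).f q) :=
    (hT.homology_exact₂ q).epi_f ((hz _).eq_of_tgt _ _)
  have : IsIso (HomologicalComplex.homologyMap (S.map (tateFunctor H)).f q) :=
    isIso_of_mono_of_epi _
  let e := asIso (HomologicalComplex.homologyMap (S.map (tateFunctor H)).f q)
  exact ⟨e⟩

lemma tateAcyclic_mappingCone_id (L : CochainComplex (Rep.{u} ℤ G) ℤ) :
    TateAcyclic (mappingCone (𝟙 L)) := fun H =>
  acyclic_homFunctor_of_homotopy _ <|
    (Homotopy.ofEq (by simp)).trans <|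
    ((Rep.resFunctor H.subtype).mapHomotopy (mappingCone.homotopyToZeroOfId L)).trans <|
    Homotopy.ofEq (by simp)

lemma nonempty_tateFunctor_single_iso (H : Subgroup G) (M : Rep.{u} ℤ G) (b : ℤ) :
    Nonempty ((tateFunctor H).obj ((HomologicalComplex.single _ (ComplexShape.up ℤ) b).obj M) ≅
      (homFunctor (completeResolution ℤ H)).obj
        ((HomologicalComplex.single _ (ComplexShape.up ℤ) b).obj (Rep.res H.subtype M))) :=
  ⟨(homFunctor (completeResolution ℤ H)).mapIso
    ((HomologicalComplex.singleMapHomologicalComplex (Rep.resFunctor H.subtype)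
      (ComplexShape.up ℤ) b).app M)⟩

lemma tateAcyclic_single_coindRep [Finite G] (M : Rep.{u} ℤ G) (b : ℤ) :
    TateAcyclic ((HomologicalComplex.single _ (ComplexShape.up ℤ) b).obj (coindRep M)) :=
  fun H i => by
    have := Fintype.ofFinite H
    obtain ⟨e⟩ := nonempty_tateFunctor_single_iso H (coindRep M) b
    exact (acyclic_homFunctor_single _ _
      (isRelProjective_coindRep M H).exists_factorization b i).of_iso e.symm

lemma nonempty_homology_tateFunctor_single_iso (H : Subgroup G) (M : Rep.{u} ℤ G) (m q : ℤ) :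
    Nonempty (((tateFunctor H).obj
        ((HomologicalComplex.single _ (ComplexShape.up ℤ) m).obj M)).homology q ≅
      ((tateFunctor H).obj
        ((HomologicalComplex.single _ (ComplexShape.up ℤ) 0).obj M)).homology (q - m)) := by
  obtain ⟨e⟩ := nonempty_tateFunctor_single_iso H M m
  obtain ⟨e'⟩ := nonempty_tateFunctor_single_iso H M 0
  obtain ⟨f⟩ := nonempty_homology_single_iso (completeResolution ℤ H) (Rep.res H.subtype M) m q
  exact ⟨(HomologicalComplex.homologyFunctor _ _ q).mapIso e ≪≫ f ≪≫
    (HomologicalComplex.homologyFunctor _ _ (q - m)).mapIso e'.symm⟩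

/-- Dimension shifting for modules, by the sequence `0 ⟶ M ⟶ (G → M) ⟶ Q ⟶ 0`. -/
lemma exists_dimension_shift [Finite G] (M : Rep.{u} ℤ G) :
    ∃ Q : Rep.{u} ℤ G, ∀ (H : Subgroup G) (q : ℤ),
      Nonempty (((tateFunctor H).obj
          ((HomologicalComplex.single _ (ComplexShape.up ℤ) 0).obj Q)).homology q ≅
        ((tateFunctor H).obj
          ((HomologicalComplex.single _ (ComplexShape.up ℤ) 0).obj M)).homology (q + 1)) := by
  have hS : (ShortComplex.mk (toCoind M) (cokernel.π (toCoind M))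
      (cokernel.condition _)).ShortExact :=
    .mk' (ShortComplex.exact_cokernel _) inferInstance inferInstance
  have hS' := hS.map_of_exact (HomologicalComplex.single _ (ComplexShape.up ℤ) 0)
  refine ⟨cokernel (toCoind M), fun H q => ?_⟩
  have hz (i : ℤ) := (tateAcyclic_single_coindRep M 0 H i).isZero_homology
  exact ⟨(shortExact_map_tateFunctor H hS').δIso q (q + 1) rfl (hz _) (hz _)⟩

lemma exists_dimension_shift_iterate [Finite G] (M : Rep.{u} ℤ G) (n : ℕ) :
    ∃ Q : Rep.{u} ℤ G, ∀ (H : Subgroup G) (q : ℤ),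
      Nonempty (((tateFunctor H).obj
          ((HomologicalComplex.single _ (ComplexShape.up ℤ) 0).obj Q)).homology q ≅
        ((tateFunctor H).obj
          ((HomologicalComplex.single _ (ComplexShape.up ℤ) 0).obj M)).homology (q + n)) := by
  induction n with
  | zero => exact ⟨M, fun H q => ⟨eqToIso (by simp)⟩⟩
  | succ n ih =>
    obtain ⟨Q, hQ⟩ := ih
    obtain ⟨Q', hQ'⟩ := exists_dimension_shift Q
    exact ⟨Q', fun H q => ⟨(hQ' H q).some ≪≫ (hQ H (q + 1)).some ≪≫
      eqToIso (by congr 1; push_cast; ring)⟩⟩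

end Tate

/-! ### Reduction to a single module -/

section Reduction

open Limits CochainComplex

variable {G : Type u} [Group G] [Finite G]

lemma tateAcyclic_single_coindRep_shift (M : Rep.{u} ℤ G) (b : ℤ) :
    TateAcyclic (((CochainComplex.singleFunctor (Rep.{u} ℤ G) b).obj (coindRep M))⟦(1 : ℤ)⟧) :=
  have h : TateAcyclic ((CochainComplex.singleFunctor (Rep.{u} ℤ G) (b - 1)).obj (coindRep M)) :=
    tateAcyclic_single_coindRep M (b - 1)
  h.of_iso
    (((CochainComplex.singleFunctors (Rep.{u} ℤ G)).shiftIso 1 (b - 1) b (by lia)).app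
      (coindRep M)).symm

lemma tateEquivalent_mappingCone {J A : CochainComplex (Rep.{u} ℤ G) ℤ} (ψ : J ⟶ A)
    (hJ : TateAcyclic (J⟦(1 : ℤ)⟧)) : TateEquivalent A (mappingCone ψ) :=
  .of_shortExact (shortExact_mappingCone ψ) hJ

/-- The last nonzero term of a complex can be removed at the cost of changing the term before it. -/
lemma exists_tateEquivalent_remove_last (A : CochainComplex (Rep.{u} ℤ G) ℤ) (b : ℤ)
    (hA : ∀ i, b < i → IsZero (A.X i)) :
    ∃ K : CochainComplex (Rep.{u} ℤ G) ℤ, TateEquivalent A K ∧ (∀ i, b ≤ i → IsZero (K.X i)) ∧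
      ∀ i, i + 1 ≠ b → IsZero (A.X i) → IsZero (K.X i) := by
  have := Fintype.ofFinite G
  obtain ⟨ψ, hψ⟩ := exists_hom_from_single A b hA (fromCoind (A.X b))
  have := epi_d_mappingCone ψ
  have hAE := tateEquivalent_mappingCone ψ (tateAcyclic_single_coindRep_shift (A.X b) b)
  have hE (i : ℤ) (hi : i + 1 ≠ b) (hi' : IsZero (A.X i)) : IsZero ((mappingCone ψ).X i) :=
    (mappingCone.isZero_X_iff _ _).2
      ⟨HomologicalComplex.isZero_single_obj_X (ComplexShape.up ℤ) b (coindRep (A.X b)) _ hi, hi'⟩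
  obtain ⟨K, L, ι, κ, w, hS, hK, hK'⟩ := exists_shortExact_contractible (mappingCone ψ) b
    fun i hi => hE i (by lia) (hA i hi)
  have hKE : TateEquivalent K (mappingCone ψ) := .of_shortExact hS (tateAcyclic_mappingCone_id L)
  exact ⟨K, hAE.trans hKE.symm, hK, fun i hi hi' => hK' i (hE i hi hi')⟩

lemma exists_tateEquivalent_remove (A : CochainComplex (Rep.{u} ℤ G) ℤ) (a b : ℤ)
    (ha : ∀ i, i < a → IsZero (A.X i)) (hb : ∀ i, b < i → IsZero (A.X i)) (n : ℕ) :
    ∃ K : CochainComplex (Rep.{u} ℤ G) ℤ, TateEquivalent A K ∧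
      (∀ i, b - n < i → IsZero (K.X i)) ∧ ∀ i, i < a → i < b - n → IsZero (K.X i) := by
  induction n with
  | zero => exact ⟨A, .of_iso (Iso.refl A), by simpa using hb, fun i hi _ => ha i hi⟩
  | succ n ih =>
    obtain ⟨K, hAK, hK, hK'⟩ := ih
    obtain ⟨K₁, hK₁, h, h'⟩ := exists_tateEquivalent_remove_last K (b - n) hK
    exact ⟨K₁, hAK.trans hK₁, fun i hi => h i (by push_cast at hi; lia),
      fun i hi hi' => h' i (by push_cast at hi'; lia) (hK' i hi (by push_cast at hi'; lia))⟩

/-- A bounded complex is Tate equivalent to a module in some degree `-n ≤ 0`. -/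
lemma exists_tateEquivalent_single (A : CochainComplex (Rep.{u} ℤ G) ℤ)
    (hA : ∃ a b : ℤ, ∀ i : ℤ, (i < a ∨ b < i) → IsZero (A.X i)) :
    ∃ (M : Rep.{u} ℤ G) (n : ℕ), TateEquivalent A
      ((HomologicalComplex.single _ (ComplexShape.up ℤ) (-n)).obj M) := by
  obtain ⟨a, b, hab⟩ := hA
  -- `-n` lies below both bounds and below `0`
  obtain ⟨n, hn⟩ : ∃ n : ℕ, -(n : ℤ) ≤ min a b := ⟨(-min a b).toNat, by lia⟩
  obtain ⟨K, hAK, hK, hK'⟩ := exists_tateEquivalent_remove A a b (fun i hi => hab i (.inl hi))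
    (fun i hi => hab i (.inr hi)) (b + n).toNat
  have hbn : b - ((b + n).toNat : ℤ) = -n := by lia
  rw [hbn] at hK hK'
  have : K.IsStrictlyGE (-n) := (isStrictlyGE_iff _ _).2 fun i hi => hK' i (by lia) hi
  have : K.IsStrictlyLE (-n) := (isStrictlyLE_iff _ _).2 fun i hi => hK i hi
  obtain ⟨M, ⟨e⟩⟩ := exists_iso_single K (-n)
  exact ⟨M, n, hAK.trans (.of_iso e)⟩

end Reduction

end TateComplexes

end

theorem mainTheorem2 {G : Type u} [Group G] [Finite G]
    (A : CochainComplex (Rep.{u} ℤ G) ℤ)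
    (hA : ∃ a b : ℤ, ∀ i : ℤ, (i < a ∨ b < i) → Limits.IsZero (A.X i)) :
    ∃ A' : Rep.{u} ℤ G, ∀ (H : Subgroup G) (q : ℤ),
      Nonempty (TateComplexes.tateCohomology H (TateComplexes.restrictComplex H A) q ≅
        TateComplexes.tateCohomologyModule H (Rep.res H.subtype A') q) := by
  obtain ⟨M, n, hM⟩ := TateComplexes.exists_tateEquivalent_single A hA
  obtain ⟨Q, hQ⟩ := TateComplexes.exists_dimension_shift_iterate M n
  refine ⟨Q, fun H q => ?_⟩
  obtain ⟨e₁⟩ := hM H q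
  obtain ⟨e₂⟩ := TateComplexes.nonempty_homology_tateFunctor_single_iso H M (-n) q
  obtain ⟨e₃⟩ := hQ H q
  obtain ⟨e₄⟩ := TateComplexes.nonempty_tateFunctor_single_iso H Q 0
  exact ⟨e₁ ≪≫ e₂ ≪≫ eqToIso (by rw [sub_neg_eq_add]) ≪≫ e₃.symm ≪≫
    (HomologicalComplex.homologyFunctor _ _ q).mapIso e₄⟩
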